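/- A \emph{skew (left) brace} is a set $B$ with two (not necessarily abelian) group structures $(B,+)$ and $(B,\circ)$ such that $a\circ(b+c)=a\circ b-a+a\circ c$ for all $a,b,c\in B$. The two groups have the same identity $0$. Put $\lambda_a(b)=-a+a\circ b$ and $a\ast b=\lambda_a(b)-b$. A \emph{sub-skew brace} of $B$ is a subset that is a subgroup of both $(B,+)$ and $(B,\circ)$; it is \emph{finitely generated} if it is the smallest sub-skew brace containing some finite subset. A skew brace is \emph{locally finite} if each of its finitely generated sub-skew braces is finite. The \emph{annihilator} of $B$ is $$\operatorname{Ann}(B)=\{x\in B:\lambda_x=\mathrm{id}_B\}\cap Z(B,+)\cap Z(B,\circ),$$ where $Z(B,+)$ and $Z(B,\circ)$ are the centres of the two groups; it is an ideal of $B$ (a subgroup of $(B,+)$ that is invariant under all $\lambda_a$ and normal in both groups), so $B/\operatorname{Ann}(B)$ is a skew brace. For $x\in B$, let $C_x^+$ and $C_x^\circ$ be the centralizers of $x$ in $(B,+)$ and $(B,\circ)$. The skew brace $B$ has \emph{property (S)} if, for every $x\in B$, the subgroup $\{b\in B: x\ast b=0\}\cap C_x^+$ has finite index in $(B,+)$ and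 the subgroup $\{b\in B: b\ast x=0\}\cap C_x^\circ$ has finite index in $(B,\circ)$. \textbf{Theorem.} If $B$ is a skew brace with property (S), then the skew brace $B/\operatorname{Ann}(B)$ is locally finite. -/

import Mathlib

/-- A skew (left) brace. The additive group `(B, +)` need not be commutative; the circle
operation of the skew brace is written `*`, so that `(B, ∘)` is the group `(B, *)`. -/
class SkewBrace (B : Type*) extends AddGroup B, Group B where
  /-- the skew left distributive law `a ∘ (b + c) = a ∘ b - a + a ∘ c` -/
  mul_add_skew : ∀ a b c : B, a * (b + c) = a * b - a + a * c

namespace SkewBrace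

section Basic

variable {B : Type*} [SkewBrace B]

/-- `λ_a(b) = -a + a ∘ b`. -/
def lam (a b : B) : B := -a + a * b

/-- `a ∗ b = λ_a(b) - b = -a + a ∘ b - b`. -/
def star (a b : B) : B := lam a b - b

theorem mul_zero_eq (a : B) : a * (0 : B) = a := by
  have h := mul_add_skew a 0 0
  rw [add_zero, sub_eq_add_neg, add_assoc] at h
  have h2 : -a + a * (0 : B) = 0 := left_eq_add.mp h
  exact (neg_add_eq_zero.mp h2).symm

theorem one_eq_zero : (1 : B) = 0 := by
  have h := mul_zero_eq (1 : B)
  rw [one_mul] at h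
  exact h.symm

theorem lam_zero (a : B) : lam a (0 : B) = 0 := by
  simp [lam, mul_zero_eq]

theorem lam_add (a b c : B) : lam a (b + c) = lam a b + lam a c := by
  simp only [lam, mul_add_skew, sub_eq_add_neg, add_assoc]

theorem lam_neg (a b : B) : lam a (-b) = -lam a b := by
  apply eq_neg_of_add_eq_zero_left
  rw [← lam_add, neg_add_cancel, lam_zero]

theorem mul_eq (a b : B) : a * b = a + lam a b := by
  simp [lam]

theorem lam_mul (a b c : B) : lam (a * b) c = lam a (lam b c) := by
  have h : lam a (-b + b * c) = lam a (-b) + lam a (b * c) := lam_add _ _ _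
  change lam (a * b) c = lam a (-b + b * c)
  rw [h, lam_neg]
  simp only [lam, neg_add_rev, neg_neg, mul_assoc, add_assoc, add_neg_cancel_left]

theorem one_lam (b : B) : lam (1 : B) b = b := by
  simp [lam, one_eq_zero (B := B) ▸ one_mul b, one_eq_zero (B := B)]

theorem lam_inv_lam (a b : B) : lam a⁻¹ (lam a b) = b := by
  rw [← lam_mul, inv_mul_cancel, one_lam]

theorem lam_lam_inv (a b : B) : lam a (lam a⁻¹ b) = b := by
  rw [← lam_mul, mul_inv_cancel, one_lam]

theorem inv_eq (a : B) : a⁻¹ = -lam a⁻¹ a := by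
  simp [lam, one_eq_zero (B := B)]

theorem star_eq_zero_iff {a b : B} : star a b = 0 ↔ lam a b = b := sub_eq_zero

/-- `Fix^r(x) = {b : x ∗ b = 0}`, a subgroup of `(B, +)`. -/
def fixR (x : B) : AddSubgroup B where
  carrier := {b | star x b = 0}
  zero_mem' := star_eq_zero_iff.mpr (lam_zero x)
  add_mem' := by
    intro a b ha hb
    rw [Set.mem_ofPred_eq, star_eq_zero_iff] at *
    rw [lam_add, ha, hb]
  neg_mem' := by
    intro a ha
    rw [Set.mem_ofPred_eq, star_eq_zero_iff] at *
    rw [lam_neg, ha]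

/-- `Fix^l(x) = {b : b ∗ x = 0}`, a subgroup of `(B, ∘)`. -/
def fixL (x : B) : Subgroup B where
  carrier := {b | star b x = 0}
  one_mem' := star_eq_zero_iff.mpr (one_lam x)
  mul_mem' := by
    intro a b ha hb
    rw [Set.mem_ofPred_eq, star_eq_zero_iff] at *
    rw [lam_mul, hb, ha]
  inv_mem' := by
    intro a ha
    rw [Set.mem_ofPred_eq, star_eq_zero_iff] at *
    nth_rewrite 1 [← ha]
    exact lam_inv_lam a x

/-- Property (s) of an element: the indices `|(B, +) : Fix^r(x) ∩ C_x^+|` and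
`|(B, ∘) : Fix^l(x) ∩ C_x^∘|` are finite. -/
def PropertyS.Elem (x : B) : Prop :=
  (fixR x ⊓ AddSubgroup.centralizer {x}).FiniteIndex ∧
    (fixL x ⊓ Subgroup.centralizer {x}).FiniteIndex

end Basic

/-- Property (S) of a skew brace: all its elements have property (s). -/
def PropertyS (B : Type*) [SkewBrace B] : Prop := ∀ x : B, PropertyS.Elem x

/-- A sub-skew brace: a subset that is a subgroup of `(B, +)` and of `(B, ∘)`. -/
structure SubBrace (B : Type*) [SkewBrace B] extends AddSubgroup B, Subgroup B

namespace SubBrace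

instance (B : Type*) [SkewBrace B] : SetLike (SubBrace B) B where
  coe S := S.carrier
  coe_injective := by
    intro S T h
    cases S
    cases T
    congr
    exact SetLike.coe_injective h

instance (B : Type*) [SkewBrace B] : PartialOrder (SubBrace B) := PartialOrder.ofSetLike (SubBrace B) B

/-- A sub-skew brace is finitely generated if it is the smallest sub-skew brace that contains
some finite set. -/
def FG {B : Type*} [SkewBrace B] (S : SubBrace B) : Prop :=
  ∃ E : Set B, E.Finite ∧ IsLeast {T : SubBrace B | E ⊆ (T : Set B)} S

end SubBrace

/-- A skew brace is locally finite if all its finitely generated sub-skew braces are finite. -/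
def LocallyFinite (B : Type*) [SkewBrace B] : Prop :=
  ∀ S : SubBrace B, S.FG → (S : Set B).Finite

/-- An ideal: a subgroup of `(B, +)` that is invariant under all `λ_a` and normal in `(B, +)` and
in `(B, ∘)`. -/
structure Ideal (B : Type*) [SkewBrace B] extends AddSubgroup B where
  lam_mem : ∀ (a : B) {x : B}, x ∈ carrier → lam a x ∈ carrier
  add_conj_mem : ∀ (a : B) {x : B}, x ∈ carrier → a + x + -a ∈ carrier
  mul_conj_mem : ∀ (a : B) {x : B}, x ∈ carrier → a * x * a⁻¹ ∈ carrier

namespace Ideal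

variable {B : Type*} [SkewBrace B] (I : Ideal B)

instance : I.toAddSubgroup.Normal := ⟨fun _ hx a => I.add_conj_mem a hx⟩

/-- An ideal as a subgroup of `(B, ∘)`. -/
def toSubgroup : Subgroup B where
  carrier := I.carrier
  one_mem' := by
    rw [one_eq_zero]
    exact I.zero_mem'
  mul_mem' := by
    intro a b ha hb
    rw [mul_eq]
    exact I.add_mem' ha (I.lam_mem a hb)
  inv_mem' := by
    intro a ha
    rw [inv_eq]
    exact I.neg_mem' (I.lam_mem _ ha)

instance : I.toSubgroup.Normal := ⟨fun _ hx a => I.mul_conj_mem a hx⟩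

/-- The additive and the multiplicative left cosets of an ideal coincide. -/
theorem neg_add_mem_iff (a b : B) : -a + b ∈ I.toAddSubgroup ↔ a⁻¹ * b ∈ I.toSubgroup := by
  have h : lam a (a⁻¹ * b) = -a + b := by simp [lam]
  constructor
  · intro hab
    have h2 := I.lam_mem a⁻¹ hab
    rw [← h, lam_inv_lam] at h2
    exact h2
  · intro hab
    rw [← h]
    exact I.lam_mem a hab

theorem mk_eq_iff (a b : B) :
    (a : B ⧸ I.toAddSubgroup) = b ↔ (a : B ⧸ I.toSubgroup) = b := by
  rw [QuotientAddGroup.eq, QuotientGroup.eq, neg_add_mem_iff]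

/-- The factor `B / I`, whose elements are the cosets `a + I = a ∘ I`. -/
def Quotient : Type _ := B ⧸ I.toAddSubgroup

/-- `B / I` is a skew brace with `(a + I) + (b + I) = (a + b) + I` and
`(a + I) ∘ (b + I) = (a ∘ b) + I`. -/
instance : SkewBrace I.Quotient where
  toAddGroup := inferInstanceAs (AddGroup (B ⧸ I.toAddSubgroup))
  mul := _root_.Quotient.map₂ (fun a b : B => a * b) (by
    intro a a' ha b b' hb
    have ha' : (a : B ⧸ I.toSubgroup) = a' := (I.mk_eq_iff _ _).mp (Quotient.sound ha)
    have hb' : (b : B ⧸ I.toSubgroup) = b' := (I.mk_eq_iff _ _).mp (Quotient.sound hb)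
    apply Quotient.exact
    apply (I.mk_eq_iff _ _).mpr
    rw [QuotientGroup.mk_mul, QuotientGroup.mk_mul, ha', hb'])
  one := ((1 : B) : B ⧸ I.toAddSubgroup)
  inv := _root_.Quotient.map (fun a : B => a⁻¹) (by
    intro a a' ha
    have ha' : (a : B ⧸ I.toSubgroup) = a' := (I.mk_eq_iff _ _).mp (Quotient.sound ha)
    apply Quotient.exact
    apply (I.mk_eq_iff _ _).mpr
    rw [QuotientGroup.mk_inv, QuotientGroup.mk_inv, ha'])
  mul_assoc := by
    rintro ⟨a⟩ ⟨b⟩ ⟨c⟩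
    exact congrArg (fun x : B => (x : B ⧸ I.toAddSubgroup)) (mul_assoc a b c)
  one_mul := by
    rintro ⟨a⟩
    exact congrArg (fun x : B => (x : B ⧸ I.toAddSubgroup)) (one_mul a)
  mul_one := by
    rintro ⟨a⟩
    exact congrArg (fun x : B => (x : B ⧸ I.toAddSubgroup)) (mul_one a)
  inv_mul_cancel := by
    rintro ⟨a⟩
    exact congrArg (fun x : B => (x : B ⧸ I.toAddSubgroup)) (inv_mul_cancel a)
  mul_add_skew := by
    rintro ⟨a⟩ ⟨b⟩ ⟨c⟩
    exact congrArg (fun x : B => (x : B ⧸ I.toAddSubgroup)) (mul_add_skew a b c)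

end Ideal

/-- The annihilator `Ann(B) = Ker(λ) ∩ Z(B, +) ∩ Z(B, ∘)`, as an ideal. -/
def annihilator (B : Type*) [SkewBrace B] : Ideal B where
  carrier := {x | (∀ b : B, lam x b = b) ∧ x ∈ AddSubgroup.center B ∧ x ∈ Subgroup.center B}
  zero_mem' := by
    refine ⟨fun b => ?_, zero_mem _, ?_⟩
    · rw [← one_eq_zero, one_lam]
    · rw [← one_eq_zero]
      exact one_mem _
  add_mem' := by
    rintro x y ⟨hx1, hx2, hx3⟩ ⟨hy1, hy2, hy3⟩
    have h : x + y = x * y := by rw [mul_eq, hx1]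
    refine ⟨fun b => ?_, add_mem hx2 hy2, ?_⟩
    · rw [h, lam_mul, hy1, hx1]
    · rw [h]
      exact mul_mem hx3 hy3
  neg_mem' := by
    rintro x ⟨hx1, hx2, hx3⟩
    have hinv : ∀ b, lam x⁻¹ b = b := fun b => by
      nth_rewrite 1 [← hx1 b]
      exact lam_inv_lam x b
    have h : -x = x⁻¹ := by rw [inv_eq, hinv]
    refine ⟨fun b => ?_, neg_mem hx2, ?_⟩
    · rw [h, hinv]
    · rw [h]
      exact inv_mem hx3
  lam_mem := by
    rintro a x ⟨hx1, hx2, hx3⟩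
    have h : lam a x = x := by
      rw [lam, ← Subgroup.mem_center_iff.mp hx3 a |>.symm, mul_eq, hx1,
        ← AddSubgroup.mem_center_iff.mp hx2 a, neg_add_cancel_left]
    rw [h]
    exact ⟨hx1, hx2, hx3⟩
  add_conj_mem := by
    rintro a x ⟨hx1, hx2, hx3⟩
    rw [AddSubgroup.mem_center_iff.mp hx2 a, add_neg_cancel_right]
    exact ⟨hx1, hx2, hx3⟩
  mul_conj_mem := by
    rintro a x ⟨hx1, hx2, hx3⟩
    rw [Subgroup.mem_center_iff.mp hx3 a, mul_inv_cancel_right]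
    exact ⟨hx1, hx2, hx3⟩

end SkewBrace

namespace SkewBrace

/-! By (S), every orbit of the maps `λ_a` is finite, so a finite set of lifts of generators lies in
a finite `F` closed under negation and all `λ_a`. Its additive span `N` is then a sub-skew brace,
and it suffices that `N` is finite modulo `Ann(B)`.

Centralizing `N` amounts to centralizing `F`, so both centralizers of `N` have finite index and a
finite `T` represents their cosets. An element of `N` in both centralizers of `T` lies in `Ann(B)`
(`mem_annihilator_of_transversal`). Additive and multiplicative cosets need not match; they are
reconciled in `PropertyS.finite_image_addClosure`: if `m ∘ n⁻¹` centralizes `N`, then `m ∘ n⁻¹ = m -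
n`. -/

theorem finite_range_of_finiteIndex {G X : Type*} [Group G] (H : Subgroup G) [H.FiniteIndex]
    (f : G → X) (hf : ∀ a b, a⁻¹ * b ∈ H → f a = f b) : (Set.range f).Finite := by
  have h : Set.range f ⊆ Set.range fun q : G ⧸ H => f q.out := by
    rintro _ ⟨g, rfl⟩
    exact ⟨g, hf _ _ (QuotientGroup.eq.mp (QuotientGroup.out_eq' (g : G ⧸ H)))⟩
  exact (Set.finite_range _).subset h

variable {B : Type*} [SkewBrace B]

theorem add_eq_mul (a b : B) : a + b = a * lam a⁻¹ b := by
  rw [mul_eq, lam_lam_inv]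

theorem mem_fixL {x b : B} : b ∈ fixL x ↔ lam b x = x := star_eq_zero_iff

theorem mem_fixR {x b : B} : b ∈ fixR x ↔ lam x b = b := star_eq_zero_iff

theorem mul_eq_add_of_mem_fixL {x b : B} (h : b ∈ fixL x) : b * x = b + x := by
  rw [mul_eq, mem_fixL.mp h]

/-! ### Centralizers of sets in the two groups. -/

/-- The elements `b` of `(B, +)` with `x ∗ b = 0` that commute additively with `x`, for all
`x ∈ F`. -/
def addCentralizer (F : Set B) : AddSubgroup B :=
  ⨅ x : F, fixR (x : B) ⊓ AddSubgroup.centralizer {(x : B)}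

/-- The elements `b` of `(B, ∘)` with `b ∗ x = 0` that commute with `x` in `(B, ∘)`, for all
`x ∈ F`. -/
def mulCentralizer (F : Set B) : Subgroup B :=
  ⨅ x : F, fixL (x : B) ⊓ Subgroup.centralizer {(x : B)}

theorem mem_addCentralizer {F : Set B} {b : B} :
    b ∈ addCentralizer F ↔ ∀ x ∈ F, lam x b = b ∧ x + b = b + x := by
  simp [addCentralizer, AddSubgroup.mem_iInf, AddSubgroup.mem_inf, mem_fixR,
    AddSubgroup.mem_centralizer_singleton_iff, eq_comm]

theorem mem_mulCentralizer {F : Set B} {b : B} :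
    b ∈ mulCentralizer F ↔ ∀ x ∈ F, lam b x = x ∧ x * b = b * x := by
  simp [mulCentralizer, Subgroup.mem_iInf, Subgroup.mem_inf, mem_fixL,
    Subgroup.mem_centralizer_singleton_iff, eq_comm]

theorem PropertyS.finiteIndex_addCentralizer (hB : PropertyS B) {F : Set B} (hF : F.Finite) :
    (addCentralizer F).FiniteIndex :=
  have := hF.to_subtype
  AddSubgroup.finiteIndex_iInf fun x : F => (hB x).1

theorem PropertyS.finiteIndex_mulCentralizer (hB : PropertyS B) {F : Set B} (hF : F.Finite) :
    (mulCentralizer F).FiniteIndex :=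
  have := hF.to_subtype
  Subgroup.finiteIndex_iInf fun x : F => (hB x).2

/-! ### Finite `λ`-invariant sets and their spans. -/

theorem PropertyS.finite_range_lam (hB : PropertyS B) (x : B) :
    (Set.range fun a : B => lam a x).Finite := by
  have := (hB x).2
  refine finite_range_of_finiteIndex (fixL x ⊓ Subgroup.centralizer {x}) _ fun a b hab => ?_
  have h := mem_fixL.mp (Subgroup.mem_inf.mp hab).1
  change lam a x = lam b x
  rw [lam_mul] at h
  rw [← lam_lam_inv a (lam b x), h]

/-- A finite subset of a skew brace with property (S) lies in a finite subset that is closed under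
negation and under all maps `λ_a`. -/
theorem PropertyS.exists_finite_invariant (hB : PropertyS B) {E : Set B} (hE : E.Finite) :
    ∃ F : Set B, F.Finite ∧ E ⊆ F ∧ (∀ x ∈ F, -x ∈ F) ∧ ∀ a, ∀ x ∈ F, lam a x ∈ F := by
  -- The union of the orbits of `E ∪ -E`; it is closed under negation because `λ_a(-e) = -λ_a(e)`.
  refine ⟨⋃ e ∈ E ∪ -E, Set.range fun a : B => lam a e,
    (hE.union hE.neg).biUnion fun e _ => hB.finite_range_lam e, ?_, ?_, ?_⟩
  · intro e he
    exact Set.mem_biUnion (Or.inl he) ⟨1, one_lam e⟩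
  · intro x hx
    obtain ⟨e, he, a, rfl⟩ := Set.mem_iUnion₂.mp hx
    refine Set.mem_biUnion (x := -e) ?_ ⟨a, lam_neg a e⟩
    simpa [or_comm] using he
  · intro a x hx
    obtain ⟨e, he, c, rfl⟩ := Set.mem_iUnion₂.mp hx
    exact Set.mem_biUnion he ⟨a * c, lam_mul a c e⟩

theorem lam_mem_addClosure {F : Set B} (hlam : ∀ a, ∀ x ∈ F, lam a x ∈ F) (a : B) {x : B}
    (hx : x ∈ AddSubgroup.closure F) : lam a x ∈ AddSubgroup.closure F := by
  induction hx using AddSubgroup.closure_induction with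
  | mem x hx => exact AddSubgroup.subset_closure (hlam a x hx)
  | zero => rw [lam_zero]; exact zero_mem _
  | add x y _ _ hx hy => rw [lam_add]; exact add_mem hx hy
  | neg x _ hx => rw [lam_neg]; exact neg_mem hx

/-- Sums become products through `x + y = x ∘ λ_{x⁻¹}(y)`. The twist by `λ` forces the induction to
treat all `λ_a(x)` at once, and the negation step forces it to carry `-x` along with `x`. -/
theorem addClosure_le_mulClosure {F : Set B} (hneg : ∀ x ∈ F, -x ∈ F)
    (hlam : ∀ a, ∀ x ∈ F, lam a x ∈ F) {x : B} (hx : x ∈ AddSubgroup.closure F) :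
    x ∈ Subgroup.closure F := by
  have key : ∀ x y : B, (∀ a, lam a x ∈ Subgroup.closure F) →
      (∀ a, lam a y ∈ Subgroup.closure F) → ∀ a, lam a (x + y) ∈ Subgroup.closure F := by
    intro x y hx hy a
    rw [lam_add, add_eq_mul, ← lam_mul]
    exact mul_mem (hx a) (hy _)
  suffices h : (∀ a, lam a x ∈ Subgroup.closure F) ∧ ∀ a, lam a (-x) ∈ Subgroup.closure F by
    simpa [one_lam] using h.1 1
  induction hx using AddSubgroup.closure_induction with
  | mem x hx =>
    exact ⟨fun a => Subgroup.subset_closure (hlam a x hx),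
      fun a => Subgroup.subset_closure (hlam a _ (hneg x hx))⟩
  | zero =>
    have h : ∀ a : B, lam a 0 ∈ Subgroup.closure F := fun a => by
      rw [lam_zero, ← one_eq_zero]
      exact one_mem _
    exact ⟨h, by rwa [neg_zero]⟩
  | add x y _ _ hx hy =>
    refine ⟨key x y hx.1 hy.1, ?_⟩
    rw [neg_add_rev]
    exact key _ _ hy.2 hx.2
  | neg x _ hx =>
    refine ⟨hx.2, ?_⟩
    rw [neg_neg]
    exact hx.1

/-- The additive subgroup generated by a `λ`-invariant set, as a sub-skew brace. -/
def SubBrace.ofInvariant (F : Set B) (hlam : ∀ a, ∀ x ∈ F, lam a x ∈ F) : SubBrace B where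
  toAddSubgroup := AddSubgroup.closure F
  one_mem' := by
    rw [one_eq_zero]
    exact zero_mem (AddSubgroup.closure F)
  mul_mem' := by
    intro a b ha hb
    rw [mul_eq]
    exact add_mem (S := AddSubgroup B) ha (lam_mem_addClosure hlam a hb)
  inv_mem' := by
    intro a ha
    rw [inv_eq]
    exact neg_mem (S := AddSubgroup B) (lam_mem_addClosure hlam _ ha)

section Invariant

variable {F : Set B} (hneg : ∀ x ∈ F, -x ∈ F) (hlam : ∀ a, ∀ x ∈ F, lam a x ∈ F)
include hneg hlam

/-- For fixed `b`, the `x` commuting additively with `b` form an additive subgroup, but those with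
`λ_x(b) = b` form a multiplicative one; hence the need for `addClosure_le_mulClosure`. -/
theorem addCentralizer_addClosure :
    addCentralizer (AddSubgroup.closure F : Set B) = addCentralizer F := by
  ext b
  simp only [mem_addCentralizer]
  refine ⟨fun h x hx => h x (AddSubgroup.subset_closure hx), fun h x hx => ⟨?_, ?_⟩⟩
  · have hle : Subgroup.closure F ≤ fixL b :=
      (Subgroup.closure_le _).mpr fun y hy => mem_fixL.mpr (h y hy).1
    exact mem_fixL.mp (hle (addClosure_le_mulClosure hneg hlam hx))
  · have hle : AddSubgroup.closure F ≤ AddSubgroup.centralizer {b} :=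
      (AddSubgroup.closure_le _).mpr fun y hy =>
        AddSubgroup.mem_centralizer_singleton_iff.mpr (h y hy).2
    exact AddSubgroup.mem_centralizer_singleton_iff.mp (hle hx)

theorem mulCentralizer_addClosure :
    mulCentralizer (AddSubgroup.closure F : Set B) = mulCentralizer F := by
  ext b
  simp only [mem_mulCentralizer]
  refine ⟨fun h x hx => h x (AddSubgroup.subset_closure hx), fun h x hx => ⟨?_, ?_⟩⟩
  · have hle : AddSubgroup.closure F ≤ fixR b :=
      (AddSubgroup.closure_le _).mpr fun y hy => mem_fixR.mpr (h y hy).1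
    exact mem_fixR.mp (hle hx)
  · have hle : Subgroup.closure F ≤ Subgroup.centralizer {b} :=
      (Subgroup.closure_le _).mpr fun y hy =>
        Subgroup.mem_centralizer_singleton_iff.mpr (h y hy).2
    exact Subgroup.mem_centralizer_singleton_iff.mp
      (hle (addClosure_le_mulClosure hneg hlam hx))

end Invariant

/-! ### Finiteness modulo the annihilator. -/

/-- If `T` together with `addCentralizer N` generates `(B, +)`, and together with
`mulCentralizer N` generates `(B, ∘)`, then an element of `N` that annihilates `T` annihilates
`B`. -/
theorem mem_annihilator_of_transversal {N T : Set B}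
    (hadd : ∀ b : B, ∃ t ∈ T, ∃ c ∈ addCentralizer N, b = t + c)
    (hmul : ∀ b : B, ∃ t ∈ T, ∃ c ∈ mulCentralizer N, b = t * c)
    {x : B} (hx : x ∈ N) (hxa : x ∈ addCentralizer T) (hxm : x ∈ mulCentralizer T) :
    x ∈ (annihilator B).toAddSubgroup := by
  rw [mem_addCentralizer] at hxa
  rw [mem_mulCentralizer] at hxm
  refine ⟨fun b => ?_, AddSubgroup.mem_center_iff.mpr fun b => ?_,
    Subgroup.mem_center_iff.mpr fun b => ?_⟩
  · obtain ⟨t, ht, c, hc, rfl⟩ := hadd b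
    rw [lam_add, (hxm t ht).1, (mem_addCentralizer.mp hc x hx).1]
  · obtain ⟨t, ht, c, hc, rfl⟩ := hadd b
    rw [add_assoc, ← (mem_addCentralizer.mp hc x hx).2, ← add_assoc, (hxa t ht).2, add_assoc]
  · obtain ⟨t, ht, c, hc, rfl⟩ := hmul b
    rw [mul_assoc, ← (mem_mulCentralizer.mp hc x hx).2, ← mul_assoc, (hxm t ht).2, mul_assoc]

/-- One set serves both groups: the union of the two systems of coset representatives. -/
theorem PropertyS.exists_finite_transversal (hB : PropertyS B) {F : Set B} (hF : F.Finite) :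
    ∃ T : Set B, T.Finite ∧ (∀ b : B, ∃ t ∈ T, ∃ c ∈ addCentralizer F, b = t + c) ∧
      ∀ b : B, ∃ t ∈ T, ∃ c ∈ mulCentralizer F, b = t * c := by
  have := hB.finiteIndex_addCentralizer hF
  have := hB.finiteIndex_mulCentralizer hF
  refine ⟨Set.range (fun q : B ⧸ addCentralizer F => q.out) ∪
    Set.range (fun q : B ⧸ mulCentralizer F => q.out),
    (Set.finite_range _).union (Set.finite_range _), fun b => ?_, fun b => ?_⟩
  · exact ⟨_, Or.inl ⟨(b : B ⧸ addCentralizer F), rfl⟩, _,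
      QuotientAddGroup.eq.mp (QuotientAddGroup.out_eq' (b : B ⧸ addCentralizer F)),
      (add_neg_cancel_left _ _).symm⟩
  · exact ⟨_, Or.inr ⟨(b : B ⧸ mulCentralizer F), rfl⟩, _,
      QuotientGroup.eq.mp (QuotientGroup.out_eq' (b : B ⧸ mulCentralizer F)),
      (mul_inv_cancel_left _ _).symm⟩

/-- In a skew brace with property (S), the additive subgroup generated by a finite `λ`-invariant
set is finite modulo the annihilator. -/
theorem PropertyS.finite_image_addClosure (hB : PropertyS B) {F : Set B} (hF : F.Finite)
    (hneg : ∀ x ∈ F, -x ∈ F) (hlam : ∀ a, ∀ x ∈ F, lam a x ∈ F) :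
    ((fun x : B => (x : B ⧸ (annihilator B).toAddSubgroup)) ''
      (AddSubgroup.closure F : Set B)).Finite := by
  obtain ⟨T, hT, hadd, hmul⟩ := hB.exists_finite_transversal hF
  rw [← addCentralizer_addClosure hneg hlam] at hadd
  rw [← mulCentralizer_addClosure hneg hlam] at hmul
  have := hB.finiteIndex_addCentralizer hT
  have := hB.finiteIndex_mulCentralizer hT
  have := hB.finiteIndex_mulCentralizer hF
  -- Inverses turn left cosets into right cosets, so that equal values give conditions on `m - n`
  -- and `m ∘ n⁻¹`.
  let φ : B → (B ⧸ addCentralizer T) × (B ⧸ mulCentralizer T) × (B ⧸ mulCentralizer F) :=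
    fun n => (((-n : B) : B ⧸ addCentralizer T), ((n⁻¹ : B) : B ⧸ mulCentralizer T),
      ((n⁻¹ : B) : B ⧸ mulCentralizer F))
  -- Picks a point of the span in each fibre of `φ` that meets it; the values at other arguments are
  -- irrelevant.
  let ψ : (B ⧸ addCentralizer T) × (B ⧸ mulCentralizer T) × (B ⧸ mulCentralizer F) →
      B ⧸ (annihilator B).toAddSubgroup :=
    fun q => ((Function.invFunOn φ (AddSubgroup.closure F : Set B) q : B) :
      B ⧸ (annihilator B).toAddSubgroup)
  refine (Set.finite_range ψ).subset ?_
  rintro _ ⟨n, hn, rfl⟩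
  refine ⟨φ n, ?_⟩
  have hex : ∃ m ∈ (AddSubgroup.closure F : Set B), φ m = φ n := ⟨n, hn, rfl⟩
  have hm := Function.invFunOn_mem hex
  have hmn := Function.invFunOn_eq hex
  change ((Function.invFunOn φ (AddSubgroup.closure F : Set B) (φ n) : B) :
    B ⧸ (annihilator B).toAddSubgroup) = n
  generalize Function.invFunOn φ (AddSubgroup.closure F : Set B) (φ n) = m at hm hmn
  simp only [φ, Prod.mk.injEq, QuotientAddGroup.eq, QuotientGroup.eq, neg_neg, inv_inv] at hmn
  obtain ⟨h1, h2, h3⟩ := hmn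
  rw [← mulCentralizer_addClosure hneg hlam] at h3
  -- Since `m ∘ n⁻¹` fixes `n` under `λ`, multiplying it by `n` is the same as adding `n`.
  have hdn : m * n⁻¹ + n = m := by
    rw [← mul_eq_add_of_mem_fixL (mem_fixL.mpr (mem_mulCentralizer.mp h3 n hn).1),
      inv_mul_cancel_right]
  have hd : m * n⁻¹ = m + -n := eq_add_neg_of_add_eq hdn
  have hmem : m + -n ∈ (annihilator B).toAddSubgroup :=
    mem_annihilator_of_transversal hadd hmul (add_mem (S := AddSubgroup B) hm (neg_mem hn)) h1
      (hd ▸ h2)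
  -- The quotient asks for `-n + m`, a conjugate of `m - n`.
  rw [eq_comm, QuotientAddGroup.eq]
  simpa [add_assoc] using (annihilator B).add_conj_mem (-n) hmem

/-! ### Passage to the factor by the annihilator. -/

/-- The image of a sub-skew brace in a factor. -/
def SubBrace.map (I : Ideal B) (S : SubBrace B) : SubBrace I.Quotient where
  carrier := (fun x : B => (x : B ⧸ I.toAddSubgroup)) '' (S : Set B)
  zero_mem' := ⟨0, S.zero_mem', rfl⟩
  one_mem' := ⟨1, S.one_mem', rfl⟩
  add_mem' := by
    rintro _ _ ⟨a, ha, rfl⟩ ⟨b, hb, rfl⟩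
    exact ⟨a + b, S.add_mem' ha hb, rfl⟩
  mul_mem' := by
    rintro _ _ ⟨a, ha, rfl⟩ ⟨b, hb, rfl⟩
    exact ⟨a * b, S.mul_mem' ha hb, rfl⟩
  neg_mem' := by
    rintro _ ⟨a, ha, rfl⟩
    exact ⟨-a, S.neg_mem' ha, rfl⟩
  inv_mem' := by
    rintro _ ⟨a, ha, rfl⟩
    exact ⟨a⁻¹, S.inv_mem' ha, rfl⟩

end SkewBrace

open SkewBrace in
theorem mainTheorem7 (B : Type*) [SkewBrace B] (hB : SkewBrace.PropertyS B) :
    SkewBrace.LocallyFinite (SkewBrace.annihilator B).Quotient := by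
  rintro S ⟨E, hE, -, hS⟩
  let s : (annihilator B).Quotient → B := fun q =>
    Quotient.out (s := QuotientAddGroup.leftRel (annihilator B).toAddSubgroup) q
  have hs : ∀ q, (QuotientAddGroup.mk (s q) : B ⧸ (annihilator B).toAddSubgroup) = q :=
    fun q => Quotient.out_eq q
  obtain ⟨F, hF, hEF, hneg, hlam⟩ := hB.exists_finite_invariant (hE.image s)
  refine (hB.finite_image_addClosure hF hneg hlam).subset
    (hS (a := SubBrace.map (annihilator B) (SubBrace.ofInvariant F hlam)) fun e he => ?_)
  exact ⟨s e, AddSubgroup.subset_closure (hEF ⟨e, he, rfl⟩), hs e⟩
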